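/- **Setting.** A $1$-current or $2$-current in $\mathbb{R}^2$ is a continuous linear functional on smooth compactly supported differential forms of that degree, $\partial T(\omega)=T(d\omega)$, and the mass $\mathbf V(T)$ is the supremum of $T(\omega)$ over forms of comass at most $1$. For $\lambda>0$ the multiscale flat norm of a $1$-current $T$ is $$\mathbb{F}_\lambda(T)=\inf_{S}\{\mathbf V(T-\partial S)+\lambda \mathbf V(S)\},$$ where $S$ runs over the integral $2$-currents in $\mathbb{R}^2$ (compactly supported, integer multiplicity, $\partial S$ of finite mass). Let $n\ge 3$ and let $T_0$ be a simple piecewise linear curve in $\mathbb{R}^2$ from $s$ to $t$ with nodes $v_0=s,v_1,\dots,v_n=t$ and edges $e_i=(v_{i-1},v_i)$: the edges are nondegenerate, consecutive edges meet exactly in their common node, and other pairs of edges are disjoint. A polygonal line is identified with the $1$-current that is the sum of its oriented edges. Write $|e_i|$ for edge lengths, $|T_0|=\sum_i|e_i|$, $e_s=e_1$, $e_t=e_n$, and $T_0[v_1,v_{n-1}]$ for the part of $T_0$ with edges $e_2,\dots,e_{n-1}$. Let $\delta>0$. A positive $\delta$-perturbation of an interior node $v$ of a polygonal line $T$, with preceding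 node $u$ and following node $w$, replaces $v$ by a point $\tilde v$ (and hence the edges $(u,v),(v,w)$ by $(u,\tilde v),(\tilde v,w)$) such that * $\|\tilde v-v\|<\delta$, * $\det[\tilde v-v,\,v-u]>0$ and $\det[\tilde v-v,\,w-v]>0$, where $\det[x,y]=x_1y_2-x_2y_1$, * the closed segment from $u$ to $\tilde v$ meets $T$ only in $u$, and the closed segment from $\tilde v$ to $w$ meets $T$ only in $w$. **Corollary (complete perturbation of the interior).** Let $\lambda>0$, and let $\tilde T_1^{0}=T_0,\ \tilde T_1^{1},\dots,\tilde T_1^{n-1}$ be such that, for $k=1,\dots,n-1$, $\tilde T_1^{k}$ arises from $\tilde T_1^{k-1}$ by a positive $\delta$-perturbation of the node $v_k$. Then $$\mathbb{F}_\lambda(\tilde T_1^{n-1}-T_0)\le\frac{\lambda\delta}{2}\Big(|T_0|+|T_0[v_1,v_{n-1}]|+(n-2)\delta\Big)=\lambda\delta\Big(|T_0|-\frac{|e_s|+|e_t|}{2}+(n-2)\frac{\delta}{2}\Big).$$ -/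

import Mathlib

open Set MeasureTheory
open scoped Distributions ENNReal

noncomputable section

/-- The Euclidean plane `ℝ²`. -/
abbrev Plane : Type := EuclideanSpace ℝ (Fin 2)

/-! ### Currents in the plane -/

/-- Smooth compactly supported differential `m`-forms on `ℝ²`, with the usual LF topology. -/
abbrev TestForm (m : ℕ) : Type :=
  𝓓((⊤ : TopologicalSpace.Opens Plane), Plane [⋀^Fin m]→L[ℝ] ℝ)

/-- `m`-currents in `ℝ²`: continuous linear functionals on the test `m`-forms. -/
abbrev Current (m : ℕ) : Type := TestForm m →L[ℝ] ℝ

/-- The exterior derivative of test forms. -/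
def extDerivTest (m : ℕ) : TestForm m →L[ℝ] TestForm (m + 1) :=
  (TestFunction.postcompCLM (ContinuousAlternatingMap.alternatizeUncurryFinCLM ℝ Plane ℝ)).comp
    (TestFunction.fderivCLM ℝ ⊤ ⊤)

theorem extDerivTest_apply {m : ℕ} (ω : TestForm m) (x : Plane) :
    extDerivTest m ω x = extDeriv ω x := by
  simp [extDerivTest, extDeriv]

/-- The boundary of a current, `∂T (ω) = T (dω)`. -/
def Current.boundary {m : ℕ} (T : Current (m + 1)) : Current m :=
  T.comp (extDerivTest m)

/-- The mass of a current: the supremum of `T ω` over the test forms `ω` of comass at most `1`.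
The comass of an alternating form on a Euclidean space equals its operator norm, by Hadamard's
inequality. For an area patch the mass is its area (counted with multiplicity), for a curve it
is its length. -/
def Current.mass {m : ℕ} (T : Current m) : ℝ≥0∞ :=
  ⨆ (ω : TestForm m) (_ : ∀ x, ‖ω x‖ ≤ 1), ENNReal.ofReal (T ω)

/-- Integral `2`-currents in `ℝ²`: compactly supported currents of integration over the plane
against an integrable integer multiplicity `θ` (the integer rectifiable currents of top
dimension; a negative multiplicity is a reversed orientation), with boundary of finite mass. -/
def Current.IsIntegral (S : Current 2) : Prop :=
  (∃ θ : Plane → ℤ, Integrable (fun x => (θ x : ℝ)) ∧ HasCompactSupport θ ∧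
    ∀ ω : TestForm 2, S ω =
      ∫ x, (θ x : ℝ) * ω x ![EuclideanSpace.single 0 1, EuclideanSpace.single 1 1]) ∧
  S.boundary.mass ≠ ⊤

/-- The multiscale flat norm of a `1`-current in `ℝ²` at scale `lam`. -/
def flatNorm (lam : ℝ) (T : Current 1) : ℝ≥0∞ :=
  ⨅ (S : Current 2) (_ : S.IsIntegral), (T - S.boundary).mass + ENNReal.ofReal lam * S.mass

theorem exists_segmentCurrent (a b : Plane) :
    ∃ A : Current 1, ∀ ω : TestForm 1,
      A ω = ∫ t in (0 : ℝ)..1, ω (AffineMap.lineMap a b t) ![b - a] := by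
  have hc : ∀ f : BoundedContinuousFunction Plane (Plane [⋀^Fin 1]→L[ℝ] ℝ),
      Continuous fun t : ℝ => f (AffineMap.lineMap a b t) ![b - a] := fun f =>
    (ContinuousAlternatingMap.apply ℝ Plane ℝ ![b - a]).continuous.comp
      (f.continuous.comp AffineMap.lineMap_continuous)
  let B : BoundedContinuousFunction Plane (Plane [⋀^Fin 1]→L[ℝ] ℝ) →ₗ[ℝ] ℝ :=
    { toFun := fun f => ∫ t in (0 : ℝ)..1, f (AffineMap.lineMap a b t) ![b - a]
      map_add' := fun f g => by
        rw [← intervalIntegral.integral_add ((hc f).intervalIntegrable _ _)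
          ((hc g).intervalIntegrable _ _)]
        simp
      map_smul' := fun c f => intervalIntegral.integral_const_mul c _ }
  have hB : ∀ f, ‖B f‖ ≤ ‖b - a‖ * ‖f‖ := fun f => by
    have h := intervalIntegral.norm_integral_le_of_norm_le_const (a := (0 : ℝ)) (b := 1)
      (C := ‖b - a‖ * ‖f‖) (f := fun t : ℝ => f (AffineMap.lineMap a b t) ![b - a])
      (fun t _ => by
        refine ((f (AffineMap.lineMap a b t)).le_opNorm _).trans ?_
        rw [mul_comm]
        simp only [Finset.univ_unique, Finset.prod_singleton, Matrix.cons_val_fin_one]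
        exact mul_le_mul_of_nonneg_left (f.norm_coe_le_norm _) (norm_nonneg _))
    rw [sub_zero, abs_one, mul_one] at h
    exact h
  exact ⟨(B.mkContinuous _ hB).comp (TestFunction.toBoundedContinuousFunctionCLM ℝ),
    fun ω => rfl⟩

/-- The current of integration along the oriented segment from `a` to `b`:
`ω ↦ ∫₀¹ ω (a + t (b - a)) (b - a) dt`. -/
def segmentCurrent (a b : Plane) : Current 1 where
  toFun ω := ∫ t in (0 : ℝ)..1, ω (AffineMap.lineMap a b t) ![b - a]
  map_add' ω η := by
    obtain ⟨A, hA⟩ := exists_segmentCurrent a b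
    simp only [← hA, map_add]
  map_smul' c ω := by
    obtain ⟨A, hA⟩ := exists_segmentCurrent a b
    simp only [← hA, map_smul, RingHom.id_apply]
  cont := by
    obtain ⟨A, hA⟩ := exists_segmentCurrent a b
    simpa only [← hA] using A.continuous

/-! ### Piecewise linear currents -/

/-- Polygonal lines with `n` edges, given by their nodes `v₀, …, vₙ`. -/
abbrev Polyline (n : ℕ) : Type := Fin (n + 1) → Plane

namespace Polyline

variable {n : ℕ}

/-- The `k`-th edge as a subset of the plane: the closed segment from node `k` to node `k + 1`
(edges are numbered from `0`). -/
def edge (T : Polyline n) (k : Fin n) : Set Plane := segment ℝ (T k.castSucc) (T k.succ)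

/-- The length of the `k`-th edge. -/
def edgeLength (T : Polyline n) (k : Fin n) : ℝ := dist (T k.castSucc) (T k.succ)

/-- The total length `|T|`. -/
def length (T : Polyline n) : ℝ := ∑ k, T.edgeLength k

/-- The underlying set of a polygonal line. -/
def support (T : Polyline n) : Set Plane := ⋃ k, T.edge k

/-- The `1`-current `e₁ + ⋯ + eₙ`. -/
def current (T : Polyline n) : Current 1 :=
  ∑ k : Fin n, segmentCurrent (T k.castSucc) (T k.succ)

/-- The part `T[vᵢ, vⱼ]` between the nodes `i ≤ j`. -/
def sub (T : Polyline n) (i j : ℕ) (hij : i ≤ j) (hj : j ≤ n) : Polyline (j - i) :=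
  fun k => T ⟨i + k, by omega⟩

end Polyline

/-- The class `𝓛ₙ[s, t]` of simple piecewise linear curves from `s` to `t` with `n` edges: edges
are nondegenerate, consecutive ones meet exactly in their common node, others are disjoint. -/
structure IsPWL (n : ℕ) (s t : Plane) (T : Polyline n) : Prop where
  start_eq : T 0 = s
  end_eq : T (Fin.last n) = t
  nondegenerate : ∀ k : Fin n, T k.castSucc ≠ T k.succ
  consecutive : ∀ i j : Fin n, (i : ℕ) + 1 = j → T.edge i ∩ T.edge j = {T j.castSucc}
  disjoint : ∀ i j : Fin n, (i : ℕ) + 1 < j → Disjoint (T.edge i) (T.edge j)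

/-! ### Positive perturbations of interior nodes -/

/-- `det [x, y]ᵀ = x₁ y₂ - x₂ y₁`. -/
def planeDet (x y : Plane) : ℝ := x 0 * y 1 - x 1 * y 0

/-- The positive cone in the open `δ`-ball at a node `v` with neighbours `u` and `w`. -/
def positiveCone (δ : ℝ) (u v w : Plane) : Set Plane :=
  {x | x ∈ Metric.ball v δ ∧ 0 < planeDet (x - v) (v - u) ∧ 0 < planeDet (x - v) (w - v)}

/-- The points `x` of the open `δ`-ball at `v` such that the new edges from `u` to `x` and from
`x` to `w` meet the curve `C` only in the nodes `u` and `w` that are kept. -/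
def allowedRegion (δ : ℝ) (u v w : Plane) (C : Set Plane) : Set Plane :=
  {x | x ∈ Metric.ball v δ ∧ segment ℝ u x ∩ C = {u} ∧ segment ℝ x w ∩ C = {w}}

/-- `T'` arises from `T` by a positive `δ`-perturbation of the interior node `k`. -/
def IsPositivePerturbation {n : ℕ} (δ : ℝ) (k : ℕ) (hk : 1 ≤ k ∧ k + 1 ≤ n)
    (T T' : Polyline n) : Prop :=
  let u := T ⟨k - 1, by omega⟩
  let v := T ⟨k, by omega⟩
  let w := T ⟨k + 1, by omega⟩
  ∃ x ∈ positiveCone δ u v w ∩ allowedRegion δ u v w T.support,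
    T' = Function.update T ⟨k, by omega⟩ x

end

/-!
The difference of two polygonal lines with the same endpoints is the boundary of the sum of the
strips between corresponding edges, because the connecting segments between corresponding nodes
cancel in pairs. If the nodes of the `k`-th edge, of length `ℓ`, move by `d` and `d'`, then cutting
the strip along a diagonal gives two triangles, of total area at most `((d + d') ℓ + d d') / 2`.
Summing over the edges, each interior edge contributes at most `δ ℓ + δ² / 2`, while the first and
the last edge, which have one fixed node each, contribute at most `δ ℓ / 2`. The current of
integration over a triangle has the expected boundary by Green's theorem on the unit square, pulled
back along the map that collapses one side of the square to a vertex.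
-/

noncomputable section

section ConeMap

variable {E F : Type*} [NormedAddCommGroup E] [NormedSpace ℝ E] [NormedAddCommGroup F]
  [NormedSpace ℝ F]

/-- The map `(r, t) ↦ (1 - r) a + r ((1 - t) b + t c)`, which collapses the unit square onto the
triangle with vertices `a`, `b` and `c` by contracting the side `r = 0` to `a`. -/
def coneMap (a b c : E) (p : ℝ × ℝ) : E :=
  AffineMap.lineMap a (AffineMap.lineMap b c p.2 : E) p.1

theorem coneMap_zero_left (a b c : E) (t : ℝ) : coneMap a b c (0, t) = a :=
  AffineMap.lineMap_apply_zero _ _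

theorem hasFDerivAt_coneMap (a b c : E) (p : ℝ × ℝ) :
    HasFDerivAt (coneMap a b c)
      (p.1 • (ContinuousLinearMap.snd ℝ ℝ ℝ).smulRight (c - b) +
        (ContinuousLinearMap.fst ℝ ℝ ℝ).smulRight ((AffineMap.lineMap b c p.2 : E) - a)) p := by
  have hside : HasFDerivAt (fun p : ℝ × ℝ => (AffineMap.lineMap b c p.2 : E))
      ((ContinuousLinearMap.snd ℝ ℝ ℝ).smulRight (c - b)) p := by
    simp only [AffineMap.lineMap_apply_module']
    exact ((hasFDerivAt_snd (𝕜 := ℝ) (p := p)).smul_const (c - b)).add_const b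
  exact ((hasFDerivAt_fst (𝕜 := ℝ) (p := p)).smul (hside.sub_const a)).add_const a

@[fun_prop]
theorem continuous_coneMap (a b c : E) : Continuous (coneMap a b c) :=
  continuous_iff_continuousAt.2 fun p => (hasFDerivAt_coneMap a b c p).continuousAt

theorem continuous_fderiv_coneMap_apply {C : E → F} (hC : ContDiff ℝ 1 C) (a b c v : E) :
    Continuous fun p => fderiv ℝ C (coneMap a b c p) v :=
  ((hC.continuous_fderiv one_ne_zero).comp (continuous_coneMap a b c)).clm_apply continuous_const

theorem image_coneMap_Icc_prod_Icc (a b c : E) :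
    coneMap a b c '' (Icc 0 1 ×ˢ Icc 0 1) = convexHull ℝ {a, b, c} := by
  rw [convexHull_insert (insert_nonempty _ _), convexHull_pair, convexJoin_singleton_left]
  ext x
  simp only [segment_eq_image_lineMap, coneMap, mem_image, Prod.exists, mem_prod, mem_iUnion,
    exists_prop, exists_exists_and_eq_and]
  grind

theorem exists_hasFDerivAt_coneMap_divergence {A B : E → F} (hA : Differentiable ℝ A)
    (hB : Differentiable ℝ B) (a b c : E) : ∃ P' Q' : ℝ × ℝ → ℝ × ℝ →L[ℝ] F,
      (∀ p, HasFDerivAt (fun p => p.1 • B (coneMap a b c p)) (P' p) p) ∧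
      (∀ p, HasFDerivAt (fun p => -(A (coneMap a b c p) + p.2 • B (coneMap a b c p))) (Q' p) p) ∧
      ∀ p, P' p (1, 0) + Q' p (0, 1) =
        p.1 • (fderiv ℝ B (coneMap a b c p) (b - a) - fderiv ℝ A (coneMap a b c p) (c - b)) := by
  -- The `1`-form with values `A` on `b - a` and `B` on `c - b` pulls back to
  -- `(A + t B) dr + r B dt`.
  have hcomp {C : E → F} (hC : Differentiable ℝ C) (p : ℝ × ℝ) :
      HasFDerivAt (fun p => C (coneMap a b c p)) _ p :=
    (hC _).hasFDerivAt.comp p (hasFDerivAt_coneMap a b c p)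
  obtain ⟨P', hP, hP'⟩ : ∃ P' : ℝ × ℝ → ℝ × ℝ →L[ℝ] F,
      (∀ p, HasFDerivAt (fun p => p.1 • B (coneMap a b c p)) (P' p) p) ∧
        ∀ p, P' p (1, 0) = B (coneMap a b c p) +
          p.1 • fderiv ℝ B (coneMap a b c p) (p.2 • (c - b) + (b - a)) :=
    ⟨_, fun p => (hasFDerivAt_fst (𝕜 := ℝ) (p := p)).smul (hcomp hB p), fun p => by
      simp [AffineMap.lineMap_apply_module', add_sub_assoc, add_comm (B _)]⟩
  obtain ⟨Q', hQ, hQ'⟩ : ∃ Q' : ℝ × ℝ → ℝ × ℝ →L[ℝ] F,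
      (∀ p, HasFDerivAt (fun p => -(A (coneMap a b c p) + p.2 • B (coneMap a b c p))) (Q' p) p) ∧
        ∀ p, Q' p (0, 1) = -(p.1 • fderiv ℝ A (coneMap a b c p) (c - b) + B (coneMap a b c p) +
          (p.2 * p.1) • fderiv ℝ B (coneMap a b c p) (c - b)) :=
    ⟨_, fun p => ((hcomp hA p).add
      ((hasFDerivAt_snd (𝕜 := ℝ) (p := p)).smul (hcomp hB p))).neg, fun p => by
      simp only [ContinuousLinearMap.comp_add, ContinuousLinearMap.comp_smulₛₗ, Real.ringHom_apply,
        smul_add, neg_add_rev, add_apply, neg_apply, ContinuousLinearMap.smulRight_apply,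
        ContinuousLinearMap.coe_snd', one_smul, smul_apply, ContinuousLinearMap.comp_apply,
        ContinuousLinearMap.coe_fst', zero_smul, map_zero, smul_zero, neg_zero, map_sub, zero_add,
        mul_smul]
      abel⟩
  refine ⟨P', Q', hP, hQ, fun p => ?_⟩
  rw [hP', hQ', map_add, map_smul]
  module

theorem integral_coneMap_green {A B : E → F} (hA : ContDiff ℝ 1 A) (hB : ContDiff ℝ 1 B)
    (a b c : E) :
    (∫ r in (0 : ℝ)..1, ∫ t in (0 : ℝ)..1, r • (fderiv ℝ B (coneMap a b c (r, t)) (b - a) -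
        fderiv ℝ A (coneMap a b c (r, t)) (c - b))) =
      (∫ r in (0 : ℝ)..1, A (coneMap a b c (r, 0))) +
        (∫ t in (0 : ℝ)..1, B (coneMap a b c (1, t))) -
        ∫ r in (0 : ℝ)..1, (A (coneMap a b c (r, 1)) + B (coneMap a b c (r, 1))) := by
  obtain ⟨P', Q', hP, hQ, hdiv⟩ := exists_hasFDerivAt_coneMap_divergence
    (hA.differentiable one_ne_zero) (hB.differentiable one_ne_zero) a b c
  have hcont : Continuous fun p : ℝ × ℝ =>
      p.1 • (fderiv ℝ B (coneMap a b c p) (b - a) - fderiv ℝ A (coneMap a b c p) (c - b)) :=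
    continuous_fst.smul ((continuous_fderiv_coneMap_apply hB a b c _).sub
      (continuous_fderiv_coneMap_apply hA a b c _))
  have hgreen := integral2_divergence_prod_of_hasFDerivAt _ _ P' Q' 0 0 1 1
    (fun p _ => (hP p).continuousAt.continuousWithinAt)
    (fun p _ => (hQ p).continuousAt.continuousWithinAt) (fun p _ => hP p) (fun p _ => hQ p)
    (by
      simp only [hdiv]
      exact hcont.continuousOn.integrableOn_compact (isCompact_uIcc.prod isCompact_uIcc))
  simp only [hdiv, one_smul, zero_smul, add_zero, intervalIntegral.integral_neg,
    intervalIntegral.integral_zero] at hgreen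
  rw [hgreen]
  abel

theorem extDeriv_apply_pair {ω : E → E [⋀^Fin 1]→L[ℝ] F} {x : E} (hω : DifferentiableAt ℝ ω x)
    (v w : E) :
    extDeriv ω x ![v, w] =
      fderiv ℝ (fun y => ω y ![w]) x v - fderiv ℝ (fun y => ω y ![v]) x w := by
  have hremove : Fin.removeNth 1 ![v, w] = ![v] := by
    ext i
    fin_cases i
    rfl
  simp [extDeriv_apply hω, Fin.sum_univ_two, sub_eq_add_neg, hremove]

theorem integral_extDeriv_coneMap {ω : E → E [⋀^Fin 1]→L[ℝ] F} (hω : ContDiff ℝ 1 ω)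
    (a b c : E) :
    (∫ r in (0 : ℝ)..1, ∫ t in (0 : ℝ)..1,
        r • extDeriv ω (coneMap a b c (r, t)) ![b - a, c - b]) =
      (∫ t in (0 : ℝ)..1, ω (AffineMap.lineMap a b t) ![b - a]) +
        (∫ t in (0 : ℝ)..1, ω (AffineMap.lineMap b c t) ![c - b]) -
        ∫ t in (0 : ℝ)..1, ω (AffineMap.lineMap a c t) ![c - a] := by
  have hcoeff (v : E) : ContDiff ℝ 1 fun x => ω x ![v] :=
    (ContinuousAlternatingMap.apply ℝ E F ![v]).contDiff.comp hω
  have hside (φ : E [⋀^Fin 1]→L[ℝ] F) : φ ![b - a] + φ ![c - b] = φ ![c - a] := by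
    rw [← φ.vecCons_add, sub_add_sub_cancel']
  have hgreen := integral_coneMap_green (hcoeff (b - a)) (hcoeff (c - b)) a b c
  simpa only [hside, ← extDeriv_apply_pair (hω.differentiable one_ne_zero _), coneMap,
    AffineMap.lineMap_apply_zero, AffineMap.lineMap_apply_one] using hgreen

end ConeMap

section PlaneDet

theorem abs_planeDet_le (x y : Plane) : |planeDet x y| ≤ ‖x‖ * ‖y‖ := by
  refine abs_le_of_sq_le_sq ?_ (by positivity)
  rw [mul_pow, EuclideanSpace.real_norm_sq_eq, EuclideanSpace.real_norm_sq_eq, Fin.sum_univ_two,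
    Fin.sum_univ_two, planeDet]
  linarith [sq_nonneg (x 0 * y 0 + x 1 * y 1)]

theorem planeDet_smul_add_smul (r t : ℝ) (x y : Plane) :
    planeDet (t • y + x) (r • y) = r * planeDet x y := by
  simp only [planeDet, PiLp.add_apply, PiLp.smul_apply, smul_eq_mul]
  ring

/-- The coefficient of a `2`-covector with respect to `dx ∧ dy`. -/
def areaCoeff : (Plane [⋀^Fin 2]→L[ℝ] ℝ) →L[ℝ] ℝ :=
  ContinuousAlternatingMap.apply ℝ Plane ℝ ![EuclideanSpace.single 0 1, EuclideanSpace.single 1 1]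

theorem areaCoeff_apply (φ : Plane [⋀^Fin 2]→L[ℝ] ℝ) :
    areaCoeff φ = φ ![EuclideanSpace.single 0 1, EuclideanSpace.single 1 1] := rfl

theorem abs_areaCoeff_le (φ : Plane [⋀^Fin 2]→L[ℝ] ℝ) : |areaCoeff φ| ≤ ‖φ‖ := by
  simpa [areaCoeff_apply] using
    φ.le_opNorm ![EuclideanSpace.single 0 1, EuclideanSpace.single 1 1]

theorem apply_eq_planeDet_mul_areaCoeff (φ : Plane [⋀^Fin 2]→L[ℝ] ℝ) (x y : Plane) :
    φ ![x, y] = planeDet x y * areaCoeff φ := by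
  have hbasis : ⇑(EuclideanSpace.basisFun (Fin 2) ℝ) =
      ![EuclideanSpace.single 0 1, EuclideanSpace.single 1 1] := by
    ext i j
    fin_cases i <;> simp
  have hdet := congrArg (fun ψ => ψ ![x, y])
    (φ.toAlternatingMap.eq_smul_basis_det (EuclideanSpace.basisFun (Fin 2) ℝ).toBasis)
  simp only [AlternatingMap.coe_mk, ContinuousMultilinearMap.coe_coe,
    ContinuousAlternatingMap.coe_toContinuousMultilinearMap, OrthonormalBasis.coe_toBasis, hbasis,
    Nat.succ_eq_add_one, Nat.reduceAdd, Fin.isValue, AlternatingMap.smul_apply,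
    Module.Basis.det_apply, Matrix.det_fin_two, Module.Basis.toMatrix_apply,
    Matrix.cons_val_zero, OrthonormalBasis.coe_toBasis_repr_apply, EuclideanSpace.basisFun_repr,
    Matrix.cons_val_one, Matrix.cons_val_fin_one, smul_eq_mul] at hdet
  rw [areaCoeff_apply, hdet, planeDet]
  ring

end PlaneDet

section TriangleIntegral

variable {a b c : Plane}

/-- The coordinates of a point of the plane. -/
def planeEquivProd : Plane ≃L[ℝ] ℝ × ℝ :=
  (EuclideanSpace.equiv (Fin 2) ℝ).trans (ContinuousLinearEquiv.finTwoArrow ℝ ℝ)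

theorem measurePreserving_planeEquivProd : MeasurePreserving planeEquivProd :=
  (volume_preserving_finTwoArrow ℝ).comp
    (EuclideanSpace.volume_preserving_symm_measurableEquiv_toLp (Fin 2))

theorem det_comp_planeEquivProd (L : ℝ × ℝ →L[ℝ] Plane) :
    (L.comp (planeEquivProd : Plane →L[ℝ] ℝ × ℝ)).det = planeDet (L (1, 0)) (L (0, 1)) := by
  rw [ContinuousLinearMap.det, ← LinearMap.det_toMatrix (EuclideanSpace.basisFun (Fin 2) ℝ).toBasis,
    Matrix.det_fin_two]
  simp [LinearMap.toMatrix_apply, planeDet, planeEquivProd, mul_comm]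

theorem setIntegral_image_plane {f : ℝ × ℝ → Plane} {f' : ℝ × ℝ → ℝ × ℝ →L[ℝ] Plane}
    {Q : Set (ℝ × ℝ)} (hQ : MeasurableSet Q) (hf : ∀ p ∈ Q, HasFDerivWithinAt f (f' p) Q p)
    (hinj : InjOn f Q) (g : Plane → ℝ) :
    ∫ x in f '' Q, g x = ∫ p in Q, |planeDet (f' p (1, 0)) (f' p (0, 1))| * g (f p) := by
  have himage : f '' Q = (f ∘ planeEquivProd) '' (planeEquivProd ⁻¹' Q) := by
    rw [image_comp, image_preimage_eq _ planeEquivProd.surjective]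
  have hderiv (x : Plane) (hx : x ∈ planeEquivProd ⁻¹' Q) :
      HasFDerivWithinAt (f ∘ planeEquivProd)
        ((f' (planeEquivProd x)).comp (planeEquivProd : Plane →L[ℝ] ℝ × ℝ))
        (planeEquivProd ⁻¹' Q) x :=
    (hf _ hx).comp x planeEquivProd.hasFDerivWithinAt (mapsTo_preimage _ _)
  rw [himage, integral_image_eq_integral_abs_det_fderiv_smul volume
    (planeEquivProd.continuous.measurable hQ) hderiv
    (hinj.comp planeEquivProd.injective.injOn (mapsTo_preimage _ _))]
  simp only [det_comp_planeEquivProd, Function.comp_apply, smul_eq_mul]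
  exact measurePreserving_planeEquivProd.setIntegral_preimage_emb
    planeEquivProd.toHomeomorph.measurableEmbedding
    (fun p => |planeDet (f' p (1, 0)) (f' p (0, 1))| * g (f p)) Q

theorem injOn_coneMap (h : planeDet (b - a) (c - b) ≠ 0) :
    InjOn (coneMap a b c) {p | p.1 ≠ 0} := by
  rintro ⟨r, t⟩ hr ⟨r', t'⟩ - heq
  have h0 := congrArg (fun x : Plane => x 0) heq
  have h1 := congrArg (fun x : Plane => x 1) heq
  simp only [coneMap, AffineMap.lineMap_apply_module', PiLp.add_apply, PiLp.smul_apply,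
    PiLp.sub_apply, smul_eq_mul, add_left_inj] at h0 h1
  obtain rfl : r = r' := by
    apply mul_right_cancel₀ h
    simp only [planeDet, PiLp.sub_apply]
    linear_combination (c 1 - b 1) * h0 - (c 0 - b 0) * h1
  have hrt : r * t = r * t' := by
    apply mul_right_cancel₀ h
    simp only [planeDet, PiLp.sub_apply]
    linear_combination (b 0 - a 0) * h1 - (b 1 - a 1) * h0
  rw [mul_left_cancel₀ hr hrt]

theorem image_coneMap_Ioc_prod_Icc :
    (coneMap a b c '' (Ioc 0 1 ×ˢ Icc 0 1) : Set Plane) =ᵐ[volume] convexHull ℝ {a, b, c} := by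
  have hsplit : insert a (coneMap a b c '' (Ioc 0 1 ×ˢ Icc 0 1)) = convexHull ℝ {a, b, c} := by
    rw [← image_coneMap_Icc_prod_Icc, ← Ioc_insert_left zero_le_one, insert_eq 0, union_prod,
      image_union, insert_eq]
    congr 1
    ext x
    simp only [mem_singleton_iff, mem_image, mem_prod, Prod.exists]
    constructor
    · rintro rfl
      exact ⟨0, 0, by simp, coneMap_zero_left _ b c 0⟩
    · rintro ⟨_, t, ⟨rfl, -⟩, rfl⟩
      exact coneMap_zero_left a b c t
  rw [← hsplit]
  exact (insert_ae_eq_self _ _).symm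

theorem setIntegral_convexHull_triangle (h : planeDet (b - a) (c - b) ≠ 0) {g : Plane → ℝ}
    (hg : Continuous g) :
    ∫ x in convexHull ℝ {a, b, c}, g x = |planeDet (b - a) (c - b)| *
      ∫ r in (0 : ℝ)..1, ∫ t in (0 : ℝ)..1, r * g (coneMap a b c (r, t)) := by
  have hQ : MeasurableSet (Ioc (0 : ℝ) 1 ×ˢ Icc (0 : ℝ) 1) :=
    measurableSet_Ioc.prod measurableSet_Icc
  have hint : IntegrableOn (fun p : ℝ × ℝ => p.1 * g (coneMap a b c p)) (Ioc 0 1 ×ˢ Icc 0 1) :=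
    ((by fun_prop : Continuous fun p : ℝ × ℝ => p.1 * g (coneMap a b c p)).continuousOn
      |>.integrableOn_compact (isCompact_Icc.prod isCompact_Icc)).mono_set
      (prod_mono Ioc_subset_Icc_self subset_rfl)
  rw [← setIntegral_congr_set image_coneMap_Ioc_prod_Icc,
    setIntegral_image_plane hQ (fun p _ => (hasFDerivAt_coneMap a b c p).hasFDerivWithinAt)
      ((injOn_coneMap h).mono fun p hp => hp.1.1.ne')]
  calc
    _ = ∫ p in Ioc 0 1 ×ˢ Icc 0 1, |planeDet (b - a) (c - b)| * (p.1 * g (coneMap a b c p)) := by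
      refine setIntegral_congr_fun hQ fun p hp => ?_
      simp [AffineMap.lineMap_apply_module', add_sub_assoc, planeDet_smul_add_smul, abs_mul,
        abs_of_pos hp.1.1, mul_left_comm, mul_assoc]
    _ = |planeDet (b - a) (c - b)| *
        ∫ r in Ioc 0 1, ∫ t in Icc 0 1, r * g (coneMap a b c (r, t)) := by
      rw [integral_const_mul, Measure.volume_eq_prod, setIntegral_prod _ hint]
    _ = _ := by
      simp only [intervalIntegral.integral_of_le zero_le_one, integral_Icc_eq_integral_Ioc]

end TriangleIntegral

section Mass

variable {m : ℕ}

theorem Current.mass_zero : (0 : Current m).mass = 0 := by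
  simp [Current.mass]

theorem Current.mass_add_le (S S' : Current m) : (S + S').mass ≤ S.mass + S'.mass := by
  refine iSup₂_le fun ω hω => ?_
  rw [add_apply]
  exact ENNReal.ofReal_add_le.trans (add_le_add
    (le_iSup₂ (f := fun (ω : TestForm m) (_ : ∀ x, ‖ω x‖ ≤ 1) => ENNReal.ofReal (S ω)) ω hω)
    (le_iSup₂ (f := fun (ω : TestForm m) (_ : ∀ x, ‖ω x‖ ≤ 1) => ENNReal.ofReal (S' ω)) ω hω))

theorem Current.mass_le_of_abs_le {S : Current m} {C : ℝ}
    (h : ∀ ω : TestForm m, (∀ x, ‖ω x‖ ≤ 1) → |S ω| ≤ C) : S.mass ≤ ENNReal.ofReal C :=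
  iSup₂_le fun ω hω => ENNReal.ofReal_le_ofReal ((le_abs_self _).trans (h ω hω))

theorem Current.boundary_add (S S' : Current (m + 1)) :
    (S + S').boundary = S.boundary + S'.boundary := rfl

theorem Current.boundary_zero : (0 : Current (m + 1)).boundary = 0 := rfl

end Mass

section Segment

theorem segmentCurrent_apply (a b : Plane) (ω : TestForm 1) : segmentCurrent a b ω =
    ∫ t in (0 : ℝ)..1, ω (AffineMap.lineMap a b t) ![b - a] := rfl

theorem segmentCurrent_swap (a b : Plane) : segmentCurrent b a = -segmentCurrent a b := by
  ext ω
  have hneg (φ : Plane [⋀^Fin 1]→L[ℝ] ℝ) : φ ![a - b] = -φ ![b - a] := by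
    rw [φ.map_vecCons_sub, φ.map_vecCons_sub, neg_sub]
  have hreverse := intervalIntegral.integral_comp_sub_left (a := 0) (b := 1)
    (fun t : ℝ => ω (AffineMap.lineMap a b t) ![b - a]) 1
  simp only [sub_self, sub_zero, AffineMap.lineMap_apply_one_sub] at hreverse
  simp only [neg_apply, segmentCurrent_apply, hneg, intervalIntegral.integral_neg, hreverse]

theorem segmentCurrent_self (a : Plane) : segmentCurrent a a = 0 :=
  ContinuousLinearMap.ext fun ω => by
    simp [segmentCurrent_apply, (ω _).map_coord_zero (m := ![0]) 0 rfl]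

theorem mass_segmentCurrent_le (a b : Plane) :
    (segmentCurrent a b).mass ≤ ENNReal.ofReal (dist a b) := by
  refine Current.mass_le_of_abs_le fun ω hω => ?_
  have hbound (t : ℝ) : ‖ω (AffineMap.lineMap a b t) ![b - a]‖ ≤ dist a b := by
    refine ((ω _).le_opNorm _).trans ?_
    simpa [dist_eq_norm'] using mul_le_mul_of_nonneg_right (hω _) (norm_nonneg (b - a))
  simpa [segmentCurrent_apply] using
    intervalIntegral.norm_integral_le_of_norm_le_const (a := 0) (b := 1) fun t _ => hbound t

end Segment

section MultiplicityCurrent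

variable {θ : Plane → ℤ}

/-- The `2`-current of integration over the plane against the integer multiplicity `θ`. It is zero
if `θ` is not locally integrable. -/
def multiplicityCurrent (θ : Plane → ℤ) : Current 2 :=
  TestFunction.integralAgainstBilinCLM ((ContinuousLinearMap.mul ℝ ℝ).comp areaCoeff) volume
    fun x => (θ x : ℝ)

theorem integrable_mul_areaCoeff (hθ : Integrable fun x => (θ x : ℝ)) (ω : TestForm 2) :
    Integrable fun x => θ x * areaCoeff (ω x) := by
  simpa [mul_comm] using TestFunction.integrable_bilin
    ((ContinuousLinearMap.mul ℝ ℝ).comp areaCoeff) (hθ.locallyIntegrable.locallyIntegrableOn _) ω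

theorem multiplicityCurrent_apply (hθ : Integrable fun x => (θ x : ℝ)) (ω : TestForm 2) :
    multiplicityCurrent θ ω = ∫ x, θ x * areaCoeff (ω x) := by
  rw [multiplicityCurrent, TestFunction.integralAgainstBilinCLM_eq_integral
    (hθ.locallyIntegrable.locallyIntegrableOn _)]
  simp [mul_comm]

theorem mass_multiplicityCurrent_le (hθ : Integrable fun x => (θ x : ℝ)) :
    (multiplicityCurrent θ).mass ≤ ENNReal.ofReal (∫ x, |(θ x : ℝ)|) := by
  refine Current.mass_le_of_abs_le fun ω hω => ?_
  rw [multiplicityCurrent_apply hθ]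
  refine norm_integral_le_of_norm_le (f := fun x => θ x * areaCoeff (ω x)) hθ.abs
    (.of_forall fun x => ?_)
  rw [Real.norm_eq_abs, abs_mul]
  exact mul_le_of_le_one_right (abs_nonneg _) ((abs_areaCoeff_le _).trans (hω x))

theorem Current.isIntegral_zero : (0 : Current 2).IsIntegral := by
  refine ⟨⟨0, by simp, HasCompactSupport.zero, by simp⟩, ?_⟩
  rw [Current.boundary_zero, Current.mass_zero]
  exact ENNReal.zero_ne_top

theorem Current.IsIntegral.add {S S' : Current 2} (hS : S.IsIntegral) (hS' : S'.IsIntegral) :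
    (S + S').IsIntegral := by
  obtain ⟨⟨θ, hint, hsupp, hSθ⟩, hbd⟩ := hS
  obtain ⟨⟨θ', hint', hsupp', hSθ'⟩, hbd'⟩ := hS'
  refine ⟨⟨θ + θ', (hint.add hint').congr (.of_forall fun x => by simp),
    hsupp.add hsupp', fun ω => ?_⟩, ?_⟩
  · simp only [← areaCoeff_apply] at hSθ hSθ' ⊢
    rw [add_apply, hSθ, hSθ', ← integral_add (integrable_mul_areaCoeff hint ω)
      (integrable_mul_areaCoeff hint' ω)]
    simp [add_mul]
  · rw [Current.boundary_add]
    exact ne_top_of_le_ne_top (ENNReal.add_ne_top.2 ⟨hbd, hbd'⟩) (Current.mass_add_le _ _)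

end MultiplicityCurrent

section TriangleCurrent

variable (a b c : Plane)

/-- The multiplicity of the oriented triangle `abc`: `1` or `-1` on the triangle, according to its
orientation, and zero everywhere if the triangle is degenerate. -/
def triangleMultiplicity : Plane → ℤ :=
  (convexHull ℝ {a, b, c}).indicator fun _ => SignType.sign (planeDet (b - a) (c - b))

theorem isCompact_convexHull_triangle : IsCompact (convexHull ℝ {a, b, c}) :=
  (toFinite ({a, b, c} : Set Plane)).isCompact_convexHull ℝ

theorem hasCompactSupport_triangleMultiplicity : HasCompactSupport (triangleMultiplicity a b c) :=
  .intro (isCompact_convexHull_triangle a b c) fun _ hx => indicator_of_notMem hx _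

theorem coe_triangleMultiplicity (x : Plane) : (triangleMultiplicity a b c x : ℝ) =
    (convexHull ℝ {a, b, c}).indicator
      (fun _ => (SignType.sign (planeDet (b - a) (c - b)) : ℝ)) x := by
  by_cases hx : x ∈ convexHull ℝ {a, b, c} <;> simp [triangleMultiplicity, hx]

theorem integrable_triangleMultiplicity :
    Integrable fun x => (triangleMultiplicity a b c x : ℝ) := by
  have hcompact := isCompact_convexHull_triangle a b c
  simp only [coe_triangleMultiplicity]
  exact (integrable_indicator_iff hcompact.measurableSet).2
    (integrableOn_const hcompact.measure_lt_top.ne)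

theorem integral_triangleMultiplicity_mul {g : Plane → ℝ} (hg : Continuous g) :
    ∫ x, triangleMultiplicity a b c x * g x = planeDet (b - a) (c - b) *
      ∫ r in (0 : ℝ)..1, ∫ t in (0 : ℝ)..1, r * g (coneMap a b c (r, t)) := by
  simp only [coe_triangleMultiplicity, ← indicator_mul_left]
  rw [integral_indicator (isCompact_convexHull_triangle a b c).measurableSet, integral_const_mul]
  by_cases h : planeDet (b - a) (c - b) = 0
  · simp [h]
  · rw [setIntegral_convexHull_triangle h hg, ← mul_assoc, sign_mul_abs]

theorem integral_abs_triangleMultiplicity :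
    ∫ x, |(triangleMultiplicity a b c x : ℝ)| = |planeDet (b - a) (c - b)| / 2 := by
  have habs (x : Plane) : |(triangleMultiplicity a b c x : ℝ)| =
      triangleMultiplicity a b c x * SignType.sign (planeDet (b - a) (c - b)) := by
    rw [coe_triangleMultiplicity]
    by_cases hx : x ∈ convexHull ℝ {a, b, c}
    · cases h : SignType.sign (planeDet (b - a) (c - b)) <;> simp [hx]
    · simp [hx]
  simp only [habs]
  rw [integral_triangleMultiplicity_mul a b c continuous_const]
  simp only [intervalIntegral.integral_const_mul, intervalIntegral.integral_const, sub_zero,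
    smul_eq_mul, one_mul, intervalIntegral.integral_mul_const, integral_id, one_pow, ne_eq,
    OfNat.ofNat_ne_zero, not_false_eq_true, zero_pow, one_div, ← self_mul_sign]
  ring

/-- The oriented triangle `abc` as a `2`-current. -/
def triangleCurrent : Current 2 := multiplicityCurrent (triangleMultiplicity a b c)

theorem mass_triangleCurrent_le :
    (triangleCurrent a b c).mass ≤ ENNReal.ofReal (|planeDet (b - a) (c - b)| / 2) :=
  integral_abs_triangleMultiplicity a b c ▸
    mass_multiplicityCurrent_le (integrable_triangleMultiplicity a b c)

theorem boundary_triangleCurrent : (triangleCurrent a b c).boundary =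
    segmentCurrent a b + segmentCurrent b c + segmentCurrent c a := by
  ext ω
  have hω : ContDiff ℝ 1 ω := ω.contDiff.of_le (by exact_mod_cast le_top)
  calc
    (triangleCurrent a b c).boundary ω
      = ∫ x, triangleMultiplicity a b c x * areaCoeff (extDerivTest 1 ω x) :=
      multiplicityCurrent_apply (integrable_triangleMultiplicity a b c) _
    _ = ∫ r in (0 : ℝ)..1, ∫ t in (0 : ℝ)..1,
        r • extDeriv ω (coneMap a b c (r, t)) ![b - a, c - b] := by
      have hcont : Continuous fun x => areaCoeff (extDerivTest 1 ω x) :=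
        areaCoeff.continuous.comp (extDerivTest 1 ω).continuous
      have hpair (x : Plane) : extDeriv ω x ![b - a, c - b] =
          planeDet (b - a) (c - b) * areaCoeff (extDeriv ω x) :=
        apply_eq_planeDet_mul_areaCoeff _ _ _
      rw [integral_triangleMultiplicity_mul a b c hcont]
      simp only [hpair, extDerivTest_apply, smul_eq_mul,
        mul_left_comm _ (planeDet _ _), intervalIntegral.integral_const_mul]
    _ = (segmentCurrent a b + segmentCurrent b c - segmentCurrent a c) ω :=
      integral_extDeriv_coneMap hω a b c
    _ = _ := by rw [segmentCurrent_swap a c, ← sub_eq_add_neg]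

theorem isIntegral_triangleCurrent : (triangleCurrent a b c).IsIntegral := by
  refine ⟨⟨_, integrable_triangleMultiplicity a b c, hasCompactSupport_triangleMultiplicity a b c,
    multiplicityCurrent_apply (integrable_triangleMultiplicity a b c)⟩, ?_⟩
  have hfinite (p q : Plane) : (segmentCurrent p q).mass ≠ ⊤ :=
    ne_top_of_le_ne_top ENNReal.ofReal_ne_top (mass_segmentCurrent_le p q)
  rw [boundary_triangleCurrent]
  refine ne_top_of_le_ne_top ?_ ((Current.mass_add_le _ _).trans
    (add_le_add_left (Current.mass_add_le _ _) _))
  simp [hfinite]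

end TriangleCurrent

section FillingArea

/-- The filling area of a `1`-current `T`: the infimum of the masses of the integral `2`-currents
with boundary `T`, which is `⊤` if there are none. -/
def fillingArea (T : Current 1) : ℝ≥0∞ :=
  ⨅ (S : Current 2) (_ : S.IsIntegral ∧ S.boundary = T), S.mass

theorem Current.IsIntegral.fillingArea_boundary_le {S : Current 2} (hS : S.IsIntegral) :
    fillingArea S.boundary ≤ S.mass :=
  iInf₂_le S ⟨hS, rfl⟩

theorem fillingArea_zero : fillingArea 0 = 0 :=
  le_antisymm (Current.isIntegral_zero.fillingArea_boundary_le.trans_eq Current.mass_zero) zero_le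

theorem fillingArea_add_le (T T' : Current 1) :
    fillingArea (T + T') ≤ fillingArea T + fillingArea T' := by
  refine ENNReal.le_iInf₂_add_iInf₂ ?_
  rintro S ⟨hS, rfl⟩ S' ⟨hS', rfl⟩
  exact (hS.add hS').fillingArea_boundary_le.trans (Current.mass_add_le S S')

theorem fillingArea_sum_le {ι : Type*} (s : Finset ι) (T : ι → Current 1) :
    fillingArea (∑ i ∈ s, T i) ≤ ∑ i ∈ s, fillingArea (T i) :=
  Finset.le_sum_of_subadditive _ fillingArea_zero.le fillingArea_add_le s T

theorem flatNorm_le_mul_fillingArea {lam : ℝ} (hlam : 0 < lam) (T : Current 1) :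
    flatNorm lam T ≤ ENNReal.ofReal lam * fillingArea T := by
  simp only [fillingArea, ENNReal.mul_iInf_of_ne (ENNReal.ofReal_pos.2 hlam).ne'
    ENNReal.ofReal_ne_top]
  refine le_iInf₂ fun S hS => (iInf₂_le S hS.1).trans_eq ?_
  rw [hS.2, sub_self, Current.mass_zero, zero_add]

theorem fillingArea_triangle_le (a b c : Plane) :
    fillingArea (segmentCurrent a b + segmentCurrent b c + segmentCurrent c a) ≤
      ENNReal.ofReal (dist a c * dist b c / 2) := by
  have hdet : planeDet (b - a) (c - b) = planeDet (c - a) (c - b) := by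
    simp only [planeDet, PiLp.sub_apply]
    ring
  rw [← boundary_triangleCurrent]
  refine (isIntegral_triangleCurrent a b c).fillingArea_boundary_le.trans
    ((mass_triangleCurrent_le a b c).trans (ENNReal.ofReal_le_ofReal ?_))
  rw [hdet, dist_eq_norm', dist_eq_norm']
  gcongr
  exact abs_planeDet_le _ _

theorem fillingArea_strip_le (u v u' v' : Plane) :
    fillingArea
        (segmentCurrent u' v' - segmentCurrent u v + (segmentCurrent v' v - segmentCurrent u' u)) ≤
      ENNReal.ofReal
        (((dist u' u + dist v' v) * dist u v + dist u' u * dist v' v) / 2) := by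
  have hsplit : segmentCurrent u' v' - segmentCurrent u v +
        (segmentCurrent v' v - segmentCurrent u' u) =
      (segmentCurrent u' v' + segmentCurrent v' v + segmentCurrent v u') +
        (segmentCurrent u' v + segmentCurrent v u + segmentCurrent u u') := by
    rw [segmentCurrent_swap u' v, segmentCurrent_swap u v, segmentCurrent_swap u' u]
    abel
  rw [hsplit]
  refine (fillingArea_add_le _ _).trans ((add_le_add (fillingArea_triangle_le u' v' v)
    (fillingArea_triangle_le u' v u)).trans ?_)
  rw [← ENNReal.ofReal_add (by positivity) (by positivity), dist_comm v u]
  refine ENNReal.ofReal_le_ofReal ?_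
  linarith [mul_le_mul_of_nonneg_right (dist_triangle u' u v) (dist_nonneg (x := v') (y := v))]

end FillingArea

theorem sum_univ_succ_castSucc {M : Type*} [AddCommMonoid M] {m : ℕ} (f : Fin (m + 2) → M) :
    ∑ k, f k = f 0 + ∑ k : Fin m, f k.castSucc.succ + f (Fin.last (m + 1)) := by
  rw [Fin.sum_univ_succ, Fin.sum_univ_castSucc, ← add_assoc, Fin.succ_last]

namespace Polyline

variable {n : ℕ}

theorem edgeLength_nonneg (P : Polyline n) (k : Fin n) : 0 ≤ P.edgeLength k := dist_nonneg

theorem current_sub_eq_sum_strip {P P' : Polyline n} (h_first : P' 0 = P 0)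
    (h_last : P' (Fin.last n) = P (Fin.last n)) :
    P'.current - P.current = ∑ k : Fin n,
      (segmentCurrent (P' k.castSucc) (P' k.succ) - segmentCurrent (P k.castSucc) (P k.succ) +
        (segmentCurrent (P' k.succ) (P k.succ) -
          segmentCurrent (P' k.castSucc) (P k.castSucc))) := by
  have htelescope := (Fin.sum_univ_succ fun j => segmentCurrent (P' j) (P j)).symm.trans
    (Fin.sum_univ_castSucc fun j => segmentCurrent (P' j) (P j))
  rw [h_first, h_last, segmentCurrent_self, segmentCurrent_self, zero_add, add_zero] at htelescope
  rw [Finset.sum_add_distrib, Finset.sum_sub_distrib, Finset.sum_sub_distrib, htelescope, sub_self,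
    add_zero, current, current]

theorem fillingArea_current_sub_le {P P' : Polyline n} (h_first : P' 0 = P 0)
    (h_last : P' (Fin.last n) = P (Fin.last n)) :
    fillingArea (P'.current - P.current) ≤ ENNReal.ofReal (∑ k : Fin n,
      ((dist (P' k.castSucc) (P k.castSucc) + dist (P' k.succ) (P k.succ)) * P.edgeLength k +
        dist (P' k.castSucc) (P k.castSucc) * dist (P' k.succ) (P k.succ)) / 2) := by
  rw [current_sub_eq_sum_strip h_first h_last, ENNReal.ofReal_sum_of_nonneg fun k _ => by
    have := P.edgeLength_nonneg k
    positivity]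
  exact (fillingArea_sum_le _ _).trans (Finset.sum_le_sum fun k _ => fillingArea_strip_le _ _ _ _)

theorem length_sub_one {m : ℕ} (P : Polyline (m + 2)) :
    (P.sub 1 (m + 1) (by omega) (by omega)).length = ∑ k : Fin m, P.edgeLength k.castSucc.succ := by
  refine Finset.sum_congr rfl fun k _ => ?_
  simp only [edgeLength, sub]
  congr 2 <;> ext <;> simp [add_comm]

theorem length_eq_add_length_sub_add {m : ℕ} (P : Polyline (m + 2)) :
    P.length = P.edgeLength 0 + (P.sub 1 (m + 1) (by omega) (by omega)).length +
      P.edgeLength (Fin.last (m + 1)) := by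
  rw [length_sub_one, length, sum_univ_succ_castSucc]

theorem sum_strip_le {m : ℕ} (P : Polyline (m + 2)) {d : Fin (m + 3) → ℝ} {δ : ℝ}
    (h_first : d 0 = 0) (h_last : d (Fin.last (m + 2)) = 0) (hd : ∀ j, d j ∈ Icc 0 δ) :
    ∑ k : Fin (m + 2), ((d k.castSucc + d k.succ) * P.edgeLength k + d k.castSucc * d k.succ) / 2 ≤
      δ / 2 * (P.length + (P.sub 1 (m + 1) (by omega) (by omega)).length + m * δ) := by
  have hδ : 0 ≤ δ := (hd 0).1.trans (hd 0).2
  have hinner (k : Fin m) :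
      ((d k.castSucc.succ.castSucc + d k.castSucc.succ.succ) * P.edgeLength k.castSucc.succ +
          d k.castSucc.succ.castSucc * d k.castSucc.succ.succ) / 2 ≤
        δ * P.edgeLength k.castSucc.succ + δ * δ / 2 := by
    have hedge := P.edgeLength_nonneg k.castSucc.succ
    have h_le := (hd k.castSucc.succ.castSucc).2
    obtain ⟨h_nonneg', h_le'⟩ := hd k.castSucc.succ.succ
    calc
      _ ≤ ((δ + δ) * P.edgeLength k.castSucc.succ + δ * δ) / 2 := by gcongr
      _ = _ := by ring
  have hfirst := mul_le_mul_of_nonneg_right (hd (Fin.succ 0)).2 (P.edgeLength_nonneg 0)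
  have hlast := mul_le_mul_of_nonneg_right (hd (Fin.last (m + 1)).castSucc).2
    (P.edgeLength_nonneg (Fin.last (m + 1)))
  have hsum := Finset.sum_le_sum fun k (_ : k ∈ Finset.univ) => hinner k
  rw [Finset.sum_add_distrib, ← Finset.mul_sum, ← length_sub_one, Finset.sum_const,
    Finset.card_univ, Fintype.card_fin, nsmul_eq_mul] at hsum
  rw [sum_univ_succ_castSucc, length_eq_add_length_sub_add, Fin.succ_last, h_last,
    Fin.castSucc_zero, h_first]
  linarith

end Polyline

namespace IsPositivePerturbation

variable {n k : ℕ} {δ : ℝ} {hk : 1 ≤ k ∧ k + 1 ≤ n} {P P' : Polyline n}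

theorem eq_of_ne (h : IsPositivePerturbation δ k hk P P') {j : Fin (n + 1)} (hj : (j : ℕ) ≠ k) :
    P' j = P j := by
  obtain ⟨x, -, rfl⟩ := h
  exact Function.update_of_ne (fun hjk => hj (congrArg Fin.val hjk)) _ _

theorem dist_lt (h : IsPositivePerturbation δ k hk P P') :
    dist (P' ⟨k, by omega⟩) (P ⟨k, by omega⟩) < δ := by
  obtain ⟨x, ⟨⟨hx, -⟩, -⟩, rfl⟩ := h
  rwa [Function.update_self]

end IsPositivePerturbation

section Perturbation

variable {n : ℕ} {δ : ℝ} {T : ℕ → Polyline n}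

theorem successivePerturbation_eq
    (hT : ∀ (k : ℕ) (hk : 1 ≤ k ∧ k + 1 ≤ n), IsPositivePerturbation δ k hk (T (k - 1)) (T k))
    {i k : ℕ} (hik : i ≤ k) (hk : k < n) {j : Fin (n + 1)} (hj : (j : ℕ) ≤ i ∨ k < j) :
    T k j = T i j := by
  induction k, hik using Nat.le_induction with
  | base => rfl
  | succ k hik ih =>
    exact ((hT (k + 1) (by omega)).eq_of_ne (by omega)).trans (ih (by omega) (by omega))

theorem dist_successivePerturbation_le (hδ : 0 ≤ δ)
    (hT : ∀ (k : ℕ) (hk : 1 ≤ k ∧ k + 1 ≤ n), IsPositivePerturbation δ k hk (T (k - 1)) (T k))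
    (j : Fin (n + 1)) : dist (T (n - 1) j) (T 0 j) ≤ δ := by
  by_cases hj : 1 ≤ (j : ℕ) ∧ (j : ℕ) + 1 ≤ n
  · rw [successivePerturbation_eq hT (i := j) (k := n - 1) (by omega) (by omega) (.inl le_rfl),
      ← successivePerturbation_eq hT (i := 0) (k := j - 1) (j := j) (by omega) (by omega)
        (.inr (by omega))]
    exact (hT j hj).dist_lt.le
  · obtain rfl | hn := Nat.eq_zero_or_pos n
    · simpa using hδ
    · rw [successivePerturbation_eq hT (i := 0) (Nat.zero_le _) (by omega) (by omega), dist_self]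
      exact hδ

end Perturbation

theorem mainTheorem7_general (n : ℕ) (hn : 2 ≤ n) (P P' : Polyline n) (lam δ : ℝ) (hlam : 0 < lam)
    (h_first : P' 0 = P 0) (h_last : P' (Fin.last n) = P (Fin.last n))
    (hdist : ∀ j, dist (P' j) (P j) ≤ δ) :
    flatNorm lam (P'.current - P.current) ≤
        ENNReal.ofReal (lam * δ / 2 *
          (P.length + (P.sub 1 (n - 1) (by omega) (by omega)).length + ((n : ℝ) - 2) * δ)) ∧
      lam * δ / 2 *
          (P.length + (P.sub 1 (n - 1) (by omega) (by omega)).length + ((n : ℝ) - 2) * δ) =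
        lam * δ *
          (P.length - (P.edgeLength ⟨0, by omega⟩ + P.edgeLength ⟨n - 1, by omega⟩) / 2 +
            ((n : ℝ) - 2) * δ / 2) := by
  obtain ⟨m, rfl⟩ := Nat.exists_eq_add_of_le' hn
  have hm : ((m + 2 : ℕ) : ℝ) - 2 = m := by
    push_cast
    ring
  have hlength : P.length = P.edgeLength ⟨0, by omega⟩ +
      (P.sub 1 (m + 2 - 1) (by omega) (by omega)).length + P.edgeLength ⟨m + 2 - 1, by omega⟩ :=
    P.length_eq_add_length_sub_add
  constructor
  · calc
      _ ≤ ENNReal.ofReal lam * fillingArea (P'.current - P.current) :=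
        flatNorm_le_mul_fillingArea hlam _
      _ ≤ ENNReal.ofReal lam * ENNReal.ofReal (δ / 2 *
          (P.length + (P.sub 1 (m + 2 - 1) (by omega) (by omega)).length + m * δ)) := by
        gcongr
        refine (Polyline.fillingArea_current_sub_le h_first h_last).trans
          (ENNReal.ofReal_le_ofReal (P.sum_strip_le (d := fun j => dist (P' j) (P j)) ?_ ?_
            fun j => ⟨dist_nonneg, hdist j⟩))
        · rw [h_first, dist_self]
        · rw [h_last, dist_self]
      _ = _ := by
        rw [← ENNReal.ofReal_mul hlam.le, hm]
        congr 1
        ring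
  · linear_combination -(lam * δ / 2) * hlength

end

theorem mainTheorem7 (n : ℕ) (hn : 3 ≤ n) (s t : Plane) (T₀ : Polyline n) (hT₀ : IsPWL n s t T₀)
    (lam δ : ℝ) (hlam : 0 < lam) (hδ : 0 < δ)
    (T : ℕ → Polyline n) (hT_zero : T 0 = T₀)
    (hT_step : ∀ (k : ℕ) (hk : 1 ≤ k ∧ k + 1 ≤ n),
      IsPositivePerturbation δ k hk (T (k - 1)) (T k)) :
    flatNorm lam ((T (n - 1)).current - T₀.current) ≤
        ENNReal.ofReal (lam * δ / 2 *
          (T₀.length + (T₀.sub 1 (n - 1) (by omega) (by omega)).length + ((n : ℝ) - 2) * δ)) ∧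
      lam * δ / 2 *
          (T₀.length + (T₀.sub 1 (n - 1) (by omega) (by omega)).length + ((n : ℝ) - 2) * δ) =
        lam * δ *
          (T₀.length - (T₀.edgeLength ⟨0, by omega⟩ + T₀.edgeLength ⟨n - 1, by omega⟩) / 2 +
            ((n : ℝ) - 2) * δ / 2) := by
  subst hT_zero
  exact mainTheorem7_general n (by omega) (T 0) (T (n - 1)) lam δ hlam
    (successivePerturbation_eq hT_step (Nat.zero_le _) (by omega) (.inl le_rfl))
    (successivePerturbation_eq hT_step (Nat.zero_le _) (by omega)
      (.inr (by rw [Fin.val_last]; omega)))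
    (dist_successivePerturbation_le hδ.le hT_step)
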